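/- Let $f,h:[0,1]\to\mathbb R$ be twice continuously differentiable with $f(1)<0<f(0)$, $h(1)=0$, $h'(1)\neq 0$ and $h>0$ on $[0,1)$, and let $\beta\in(0,1/2)$. For $\varepsilon>0$ let $x^\varepsilon:[0,\infty)\to[0,1]$ be the solution of $\varepsilon\,\dot x^\varepsilon_s=\varepsilon f(x^\varepsilon_s)+x^\varepsilon_s\,h(x^\varepsilon_s)$, $x^\varepsilon_0=0$. Let $(\sigma^\varepsilon_n)_{n\ge1}$ be i.i.d. positive random variables with $$\mathbb P(\sigma^\varepsilon_n>s)=\exp\Big(-\varepsilon^{-1}\int_0^s h(x^\varepsilon_r)\,dr\Big)\qquad(s>0),$$ and put $\tau^\varepsilon_0=0$, $\tau^\varepsilon_n=\sigma^\varepsilon_1+\dots+\sigma^\varepsilon_n$. Let $X^\varepsilon$ be the càdlàg process given by $X^\varepsilon_s=x^\varepsilon_{s-\tau^\varepsilon_n}$ for $s\in[\tau^\varepsilon_n,\tau^\varepsilon_{n+1})$, $n\ge0$; let $e^\varepsilon_1=\inf\{s\ge0:\ X^\varepsilon_s>1-\varepsilon^\beta\}\in[0,\infty]$ and let $$\mathbb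 Q^\varepsilon=\sum_{i\ge1}\delta_{(\tau^\varepsilon_i,\,X^\varepsilon_{\tau^\varepsilon_i-})},\qquad \mathbb Q^\varepsilon_0(A)=\mathbb Q^\varepsilon\big(A\cap([0,e^\varepsilon_1)\times[0,1])\big)$$ for Borel sets $A \subset [0,\infty)\times[0,1]$. Fix $t>0$. Then for every $\delta>0$ there is a constant $K<\infty$ such that $$\limsup_{\varepsilon\to0}\ \mathbb E\big[\mathbb Q^\varepsilon_0([0,t]\times[\delta,1])\big]\le K .$$ -/

import Mathlib

open MeasureTheory ProbabilityTheory Filter Topology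
open scoped ENNReal NNReal

noncomputable section

namespace Resetting

/-- Standing assumptions on `f, h : [0,1] → ℝ` (values outside `[0,1]` play no role). -/
structure Admissible (f h : ℝ → ℝ) : Prop where
  contDiffOn_f : ContDiffOn ℝ 2 f (Set.Icc 0 1)
  contDiffOn_h : ContDiffOn ℝ 2 h (Set.Icc 0 1)
  f_one_neg : f 1 < 0
  f_zero_pos : 0 < f 0
  h_one : h 1 = 0
  h_deriv_one : derivWithin h (Set.Icc 0 1) 1 ≠ 0
  h_pos : ∀ x ∈ Set.Ico (0 : ℝ) 1, 0 < h x

/-- The function `ω^ε (x) = ε f(x) + x h(x)`. -/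
def drift (f h : ℝ → ℝ) (ε x : ℝ) : ℝ := ε * f x + x * h x

/-- `x` is the solution, on the time interval `[0,∞)` and with state space `[0,1]`, of the
equation `ε x' = ω^ε (x)` with `x 0 = 0` (values at negative times play no role). -/
structure IsFlow (f h : ℝ → ℝ) (ε : ℝ) (x : ℝ → ℝ) : Prop where
  init : x 0 = 0
  mem_Icc : ∀ t, 0 ≤ t → x t ∈ Set.Icc (0 : ℝ) 1
  ode : ∀ t, 0 ≤ t → HasDerivWithinAt x (ε⁻¹ * drift f h ε (x t)) (Set.Ici 0) t

/-- The survival function `μ_t^ε = exp (- ε⁻¹ ∫_0^t h (x_s^ε) ds)`. -/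
def survival (h : ℝ → ℝ) (ε : ℝ) (x : ℝ → ℝ) (t : ℝ) : ℝ :=
  Real.exp (-(ε⁻¹ * ∫ s in (0 : ℝ)..t, h (x s)))

/-- `σ 0, σ 1, …` (the inter-arrival times `σ_1, σ_2, …`) are independent positive random
variables, all with the survival function `μ^ε`. -/
structure IsInterArrival {Ω : Type*} [MeasurableSpace Ω] (P : Measure Ω)
    (h : ℝ → ℝ) (ε : ℝ) (x : ℝ → ℝ) (σ : ℕ → Ω → ℝ) : Prop where
  measurable : ∀ n, Measurable (σ n)
  pos : ∀ n, ∀ᵐ ω ∂P, 0 < σ n ω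
  indep : iIndepFun σ P
  law : ∀ n, ∀ t, 0 < t → P {ω | t < σ n ω} = ENNReal.ofReal (survival h ε x t)

/-- The pre-spike times `τ_n = σ_1 + … + σ_n`, `τ_0 = 0`, of a realisation `s` of the
inter-arrival times, where `s k` is `σ_{k+1}`. -/
def spikeTime (s : ℕ → ℝ) (n : ℕ) : ℝ := ∑ k ∈ Finset.range n, s k

/-- The index `n` with `t ∈ [τ_n, τ_{n+1})`. -/
def resetIndex (s : ℕ → ℝ) (t : ℝ) : ℕ := sSup {n : ℕ | spikeTime s n ≤ t}

/-- The resetting path: `X_t = x_{t - τ_n}` for `t ∈ [τ_n, τ_{n+1})`. -/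
def path (x : ℝ → ℝ) (s : ℕ → ℝ) (t : ℝ) : ℝ := x (t - spikeTime s (resetIndex s t))

/-- The height `z_n = X_{τ_n -}` of the `n`-th pre-spike. -/
def spikeHeight (x : ℝ → ℝ) (s : ℕ → ℝ) (n : ℕ) : ℝ :=
  Function.leftLim (path x s) (spikeTime s n)

/-- The point process `ℚ^ε = ∑_{i ≥ 1} δ_{(τ_i, z_i)}` of a realisation. -/
def pointProcess (x : ℝ → ℝ) (s : ℕ → ℝ) : Measure (ℝ × ℝ) :=
  Measure.sum fun i : ℕ => Measure.dirac (spikeTime s (i + 1), spikeHeight x s (i + 1))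

/-- The level `y_*^ε = 1 - ε ^ β`. -/
def level (β ε : ℝ) : ℝ := 1 - ε ^ β

/-- The first jump time `e_1 = inf {t ≥ 0 ; X_t > y}` above the level `y`, equal to `+∞` when
the level is never exceeded. -/
def jumpTime (x : ℝ → ℝ) (s : ℕ → ℝ) (y : ℝ) : EReal :=
  sInf ((fun t : ℝ => (t : EReal)) '' {t : ℝ | 0 ≤ t ∧ y < path x s t})

/-- The point process `ℚ_0^ε`: the restriction of `ℚ^ε` to the time interval `[0, e_1)`. -/
def pointProcessZero (x : ℝ → ℝ) (s : ℕ → ℝ) (y : ℝ) : Measure (ℝ × ℝ) :=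
  (pointProcess x s).restrict
    ({r : ℝ | 0 ≤ r ∧ (r : EReal) < jumpTime x s y} ×ˢ Set.Icc (0 : ℝ) 1)

/-- The expectation `𝔼 [ℚ_0^ε (A)] ∈ [0, ∞]`. -/
def expectedCount {Ω : Type*} [MeasurableSpace Ω] (P : Measure Ω) (x : ℝ → ℝ)
    (σ : ℕ → Ω → ℝ) (y : ℝ) (A : Set (ℝ × ℝ)) : ℝ≥0∞ :=
  ∫⁻ ω, pointProcessZero x (fun n => σ n ω) y A ∂P

end Resetting

end

namespace Resetting

/-! A cycle ends above `δ` with probability O(ε), and the expected number of cycles started by time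
`t` is O(1/ε); the product stays bounded. For the first, choose `a > 0` with `f ≤ a * h`. Then `(x +
aε) * survival` is nonincreasing and starts at `aε`, so survival up to the first time the flow
reaches `δ` is at most `aε/δ` (`exists_time`). For the second, `𝔼 exp(-σ) ≤ 1 - cε`, so a Chernoff
bound on `τ_n ≤ t` is geometric in `n` (`measure_inter_le`). Independence of `τ_n` and the next
cycle length multiplies the two estimates. -/

theorem Admissible.exists_le_mul {f h : ℝ → ℝ} (hfh : Admissible f h) :
    ∃ a : ℝ, 0 < a ∧ ∀ y ∈ Set.Icc (0 : ℝ) 1, f y ≤ a * h y := by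
  have hf := hfh.contDiffOn_f.continuousOn
  have hh := hfh.contDiffOn_h.continuousOn
  have hcl : IsCompact (Set.Icc (0 : ℝ) 1 ∩ f ⁻¹' Set.Ici 0) :=
    isCompact_Icc.of_isClosed_subset
      (hf.preimage_isClosed_of_isClosed isClosed_Icc isClosed_Ici) Set.inter_subset_left
  have hpos : ∀ y ∈ Set.Icc (0 : ℝ) 1 ∩ f ⁻¹' Set.Ici 0, 0 < h y := by
    rintro y ⟨hy, hfy⟩
    refine hfh.h_pos y ⟨hy.1, lt_of_le_of_ne hy.2 ?_⟩
    rintro rfl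
    exact absurd hfh.f_one_neg (not_lt.mpr hfy)
  obtain ⟨a, ha⟩ := hcl.exists_bound_of_continuousOn (f := fun y => f y / h y)
    ((hf.mono Set.inter_subset_left).div (hh.mono Set.inter_subset_left)
      fun y hy => (hpos y hy).ne')
  refine ⟨max a 1, by positivity, fun y hy => ?_⟩
  have hhy : 0 ≤ h y := by
    rcases hy.2.eq_or_lt with h1 | h1
    · rw [h1, hfh.h_one]
    · exact (hfh.h_pos y ⟨hy.1, h1⟩).le
  rcases le_or_gt 0 (f y) with h0 | h0
  · have h1 := (le_abs_self _).trans (ha y ⟨hy, h0⟩)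
    rw [div_le_iff₀ (hpos y ⟨hy, h0⟩)] at h1
    exact h1.trans (mul_le_mul_of_nonneg_right (le_max_left _ _) hhy)
  · exact h0.le.trans (by positivity)

section Flow

variable {f h x : ℝ → ℝ} {ε : ℝ}

theorem IsFlow.continuousOn (hx : IsFlow f h ε x) : ContinuousOn x (Set.Ici 0) :=
  fun t ht => (hx.ode t ht).continuousWithinAt

/-- Freezing the flow at negative times gives an integrand continuous on all of ℝ, as the
fundamental theorem of calculus needs. -/
theorem IsFlow.continuous_comp_max (hfh : Admissible f h) (hx : IsFlow f h ε x) :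
    Continuous fun s => h (x (max s 0)) := by
  refine hfh.contDiffOn_h.continuousOn.comp_continuous ?_ fun s => hx.mem_Icc _ (le_max_right _ _)
  exact hx.continuousOn.comp_continuous (by fun_prop) fun s => Set.mem_Ici.mpr (le_max_right s 0)

theorem survival_eq {t : ℝ} (ht : 0 ≤ t) :
    survival h ε x t = Real.exp (-(ε⁻¹ * ∫ s in (0 : ℝ)..t, h (x (max s 0)))) := by
  unfold survival
  congr 3
  refine intervalIntegral.integral_congr fun s hs => ?_
  rw [Set.uIcc_of_le ht] at hs
  simp [max_eq_left hs.1]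

theorem IsFlow.continuousOn_survival (hfh : Admissible f h) (hx : IsFlow f h ε x) :
    ContinuousOn (survival h ε x) (Set.Ici 0) := by
  have hg := hx.continuous_comp_max hfh
  refine ContinuousOn.congr (Continuous.continuousOn ?_) fun t ht => survival_eq ht
  have := intervalIntegral.continuous_primitive (μ := volume)
    (fun a b => hg.intervalIntegrable a b) 0
  fun_prop

/-- `(x + aε) · μ^ε` decreases along the flow. -/
theorem IsFlow.add_mul_survival_le (hfh : Admissible f h) (hx : IsFlow f h ε x) (hε : 0 < ε)
    {a : ℝ} (ha : ∀ y ∈ Set.Icc (0 : ℝ) 1, f y ≤ a * h y) {t : ℝ} (ht : 0 ≤ t) :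
    (x t + a * ε) * survival h ε x t ≤ a * ε := by
  have hg := hx.continuous_comp_max hfh
  set G : ℝ → ℝ := fun t => Real.exp (-(ε⁻¹ * ∫ s in (0 : ℝ)..t, h (x (max s 0)))) with hG
  have hGd : ∀ s, HasDerivAt G (G s * (-(ε⁻¹ * h (x (max s 0))))) s := fun s =>
    (((hg.integral_hasStrictDerivAt 0 s).hasDerivAt.const_mul ε⁻¹).neg).exp
  have hd : ∀ s, 0 < s → HasDerivAt (fun s => (x s + a * ε) * G s)
      (ε⁻¹ * drift f h ε (x s) * G s + (x s + a * ε) * (G s * (-(ε⁻¹ * h (x (max s 0)))))) s :=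
    fun s hs => ((((hx.ode s hs.le).hasDerivAt (Ici_mem_nhds hs)).add_const _).mul (hGd s))
  have hanti : AntitoneOn (fun s => (x s + a * ε) * G s) (Set.Ici 0) := by
    refine antitoneOn_of_deriv_nonpos (convex_Ici 0) ?_ ?_ ?_
    · exact (hx.continuousOn.add continuousOn_const).mul
        fun s _ => (hGd s).continuousAt.continuousWithinAt
    · intro s hs
      rw [interior_Ici] at hs
      exact (hd s hs).differentiableAt.differentiableWithinAt
    · intro s hs
      rw [interior_Ici] at hs
      have hs' : 0 < s := hs
      rw [(hd s hs).deriv, max_eq_left hs'.le]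
      have h1 := ha _ (hx.mem_Icc s hs'.le)
      have h2 : 0 < G s := Real.exp_pos _
      -- The singular terms `ε⁻¹ x h` from growth and killing cancel.
      have h3 : ε⁻¹ * drift f h ε (x s) * G s + (x s + a * ε) * (G s * (-(ε⁻¹ * h (x s))))
          = G s * (f (x s) - a * h (x s)) := by
        unfold drift
        field_simp
        ring
      rw [h3]
      exact mul_nonpos_of_nonneg_of_nonpos h2.le (by linarith)
  have := hanti Set.self_mem_Ici ht ht
  simpa [hG, hx.init, survival_eq ht] using this

/-- The hazard rate is at most `M/ε`, so a cycle outlasts time `ε` with probability bounded below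
uniformly in `ε`. -/
theorem IsFlow.exp_neg_le_survival (hfh : Admissible f h) (hx : IsFlow f h ε x) (hε : 0 < ε)
    {M : ℝ} (hM : ∀ y ∈ Set.Icc (0 : ℝ) 1, h y ≤ M) :
    Real.exp (-M) ≤ survival h ε x ε := by
  rw [survival_eq hε.le]
  have hg := hx.continuous_comp_max hfh
  have : (∫ s in (0 : ℝ)..ε, h (x (max s 0))) ≤ ∫ _s in (0 : ℝ)..ε, M :=
    intervalIntegral.integral_mono hε.le (hg.intervalIntegrable _ _) (by simp)
      fun s => hM _ (hx.mem_Icc _ (le_max_right _ _))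
  rw [intervalIntegral.integral_const, sub_zero, smul_eq_mul] at this
  refine Real.exp_le_exp.mpr (neg_le_neg ?_)
  rw [inv_mul_le_iff₀ hε]
  exact this

end Flow

section Path

theorem spikeTime_strictMono {s : ℕ → ℝ} (hs : ∀ n, 0 < s n) : StrictMono (spikeTime s) :=
  strictMono_nat_of_lt_succ fun n => by
    simp [spikeTime, Finset.sum_range_succ, hs n]

theorem resetIndex_eq {s : ℕ → ℝ} (hs : ∀ n, 0 < s n) {u : ℝ} {n : ℕ}
    (h1 : spikeTime s n ≤ u) (h2 : u < spikeTime s (n + 1)) : resetIndex s u = n := by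
  have hset : {k : ℕ | spikeTime s k ≤ u} = Set.Iic n := by
    ext k
    simp only [Set.mem_ofPred_eq, Set.mem_Iic]
    constructor
    · intro hk
      exact Nat.lt_succ_iff.mp ((spikeTime_strictMono hs).lt_iff_lt.mp (hk.trans_lt h2))
    · intro hk
      exact ((spikeTime_strictMono hs).monotone hk).trans h1
  rw [resetIndex, hset, csSup_Iic]

theorem spikeHeight_succ {x : ℝ → ℝ} (hx : ContinuousOn x (Set.Ici 0)) {s : ℕ → ℝ}
    (hs : ∀ n, 0 < s n) (n : ℕ) : spikeHeight x s (n + 1) = x (s n) := by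
  have hlt : spikeTime s n < spikeTime s (n + 1) := spikeTime_strictMono hs (Nat.lt_succ_self n)
  have hsub : spikeTime s (n + 1) - spikeTime s n = s n := by
    simp [spikeTime, Finset.sum_range_succ]
  refine leftLim_eq_of_tendsto ?_
  have hc : ContinuousAt (fun u => x (u - spikeTime s n)) (spikeTime s (n + 1)) := by
    refine ContinuousAt.comp (g := x) ?_ (by fun_prop)
    rw [hsub]
    exact hx.continuousAt (Ici_mem_nhds (hs n))
  have ht : Tendsto (fun u => x (u - spikeTime s n)) (𝓝[<] spikeTime s (n + 1)) (𝓝 (x (s n))) := by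
    have := hc.tendsto
    rw [hsub] at this
    exact this.mono_left nhdsWithin_le_nhds
  refine ht.congr' ?_
  filter_upwards [Ioo_mem_nhdsLT hlt] with u hu
  rw [path, resetIndex_eq hs hu.1.le hu.2]

end Path

section Probability

variable {Ω : Type*} [MeasurableSpace Ω] {P : Measure Ω}
  {f h x : ℝ → ℝ} {ε : ℝ} {σ : ℕ → Ω → ℝ}

theorem IsInterArrival.measurable_spikeTime (hσ : IsInterArrival P h ε x σ) (n : ℕ) :
    Measurable fun ω => spikeTime (fun k => σ k ω) n :=
  Finset.measurable_sum _ fun k _ => hσ.measurable k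

theorem IsInterArrival.indepFun_spikeTime (hσ : IsInterArrival P h ε x σ) (n : ℕ) :
    IndepFun (fun ω => spikeTime (fun k => σ k ω) n) (σ n) P := by
  have := hσ.indep.indepFun_finsetSum_of_notMem hσ.measurable
    (s := Finset.range n) (i := n) (by simp)
  convert this using 1
  ext ω
  simp [spikeTime]

/-- The law is given for strict inequalities; continuity of the survival function lets `u ↑ T`. -/
theorem IsInterArrival.measure_le_survival (hσ : IsInterArrival P h ε x σ)
    (hfh : Admissible f h) (hx : IsFlow f h ε x) {T : ℝ} (hT : 0 < T) (n : ℕ) :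
    P {ω | T ≤ σ n ω} ≤ ENNReal.ofReal (survival h ε x T) := by
  have hc : Tendsto (survival h ε x) (𝓝[<] T) (𝓝 (survival h ε x T)) :=
    (((hx.continuousOn_survival hfh).continuousAt (Ici_mem_nhds hT)).tendsto).mono_left
      nhdsWithin_le_nhds
  refine ge_of_tendsto (ENNReal.tendsto_ofReal hc) ?_
  filter_upwards [Ioo_mem_nhdsLT hT] with u hu
  rw [← hσ.law n u hu.1]
  exact measure_mono fun ω hω => hu.2.trans_le hω

/-- A flow from `0` is above `δ` at the end of a cycle with probability `O(ε)`. -/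
theorem IsInterArrival.exists_time (hσ : IsInterArrival P h ε x σ)
    (hfh : Admissible f h) (hx : IsFlow f h ε x) (hε : 0 < ε)
    {a : ℝ} (ha0 : 0 < a) (ha : ∀ y ∈ Set.Icc (0 : ℝ) 1, f y ≤ a * h y) {δ : ℝ} (hδ : 0 < δ) :
    ∃ S : Set ℝ, MeasurableSet S ∧ (∀ s, 0 ≤ s → δ ≤ x s → s ∈ S) ∧
      ∀ n, P (σ n ⁻¹' S) ≤ ENNReal.ofReal (a * ε / δ) := by
  set R : Set ℝ := Set.Ici 0 ∩ x ⁻¹' Set.Ici δ with hR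
  have hcl : IsClosed R := hx.continuousOn.preimage_isClosed_of_isClosed isClosed_Ici isClosed_Ici
  have hbdd : BddBelow R := ⟨0, fun s hs => hs.1⟩
  rcases R.eq_empty_or_nonempty with he | hne
  · refine ⟨∅, MeasurableSet.empty, fun s h0 hs => ?_, by simp⟩
    exact (he ▸ (⟨h0, hs⟩ : s ∈ R) : s ∈ (∅ : Set ℝ))
  have hT : sInf R ∈ R := hcl.csInf_mem hne hbdd
  have hT0 : 0 < sInf R := by
    refine lt_of_le_of_ne hT.1 fun h0 => ?_
    have h1 : δ ≤ x (sInf R) := hT.2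
    rw [← h0, hx.init] at h1
    linarith
  -- Taking all times after the first hitting time of `δ` avoids any monotonicity of the flow.
  refine ⟨Set.Ici (sInf R), measurableSet_Ici, fun s h0 hs => csInf_le hbdd ⟨h0, hs⟩, fun n => ?_⟩
  refine (hσ.measure_le_survival hfh hx hT0 n).trans (ENNReal.ofReal_le_ofReal ?_)
  rw [le_div_iff₀ hδ]
  have h1 := hx.add_mul_survival_le hfh hε ha hT.1
  have h2 : δ ≤ x (sInf R) := hT.2
  have h3 : 0 < survival h ε x (sInf R) := Real.exp_pos _
  nlinarith [mul_pos (mul_pos ha0 hε) h3]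

theorem IsInterArrival.lintegral_exp_neg_le [IsProbabilityMeasure P] (hσ : IsInterArrival P h ε x σ)
    (hfh : Admissible f h) (hx : IsFlow f h ε x) (hε : 0 < ε) (hε1 : ε ≤ 1)
    {M : ℝ} (hM : ∀ y ∈ Set.Icc (0 : ℝ) 1, h y ≤ M) (n : ℕ) :
    ∫⁻ ω, ENNReal.ofReal (Real.exp (-σ n ω)) ∂P
      ≤ ENNReal.ofReal (1 - Real.exp (-M) * (ε / 2)) := by
  have hms : MeasurableSet {ω | ε < σ n ω} := measurableSet_lt measurable_const (hσ.measurable n)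
  have hreal : Real.exp (-M) ≤ P.real {ω | ε < σ n ω} := by
    rw [measureReal_def, hσ.law n ε hε, ENNReal.toReal_ofReal (by unfold survival; positivity)]
    exact hx.exp_neg_le_survival hfh hε hM
  -- `exp(-ε) ≤ 1/(1+ε) ≤ 1 - ε/2`, the last since `ε ≤ 1`.
  have hexp : Real.exp (-ε) ≤ 1 - ε / 2 := by
    have h1 := Real.add_one_le_exp ε
    rw [Real.exp_neg, inv_le_iff_one_le_mul₀ (Real.exp_pos _)]
    nlinarith
  have hint : Integrable (fun ω => 1 - {ω | ε < σ n ω}.indicator (fun _ => ε / 2) ω) P :=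
    (integrable_const _).sub ((integrable_const _).indicator hms)
  have hb : ∀ᵐ ω ∂P, ENNReal.ofReal (Real.exp (-σ n ω)) ≤
      ENNReal.ofReal (1 - {ω | ε < σ n ω}.indicator (fun _ => ε / 2) ω) := by
    filter_upwards [hσ.pos n] with ω hω
    refine ENNReal.ofReal_le_ofReal ?_
    by_cases hc : ε < σ n ω
    · rw [Set.indicator_of_mem (show ω ∈ {ω | ε < σ n ω} from hc)]
      exact (Real.exp_le_exp.mpr (by linarith)).trans hexp
    · rw [Set.indicator_of_notMem (show ω ∉ {ω | ε < σ n ω} from hc), sub_zero]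
      exact Real.exp_le_one_iff.mpr (by linarith)
  refine (lintegral_mono_ae hb).trans ?_
  rw [← ofReal_integral_eq_lintegral_ofReal hint (ae_of_all _ fun ω => ?_)]
  · refine ENNReal.ofReal_le_ofReal ?_
    rw [integral_sub (integrable_const _) ((integrable_const _).indicator hms),
      integral_indicator_const _ hms]
    simp only [integral_const, probReal_univ, smul_eq_mul, one_mul]
    nlinarith
  · simp only [Set.indicator, Pi.zero_apply]
    split_ifs <;> linarith

theorem IsInterArrival.lintegral_exp_neg_spikeTime_le [IsProbabilityMeasure P]
    (hσ : IsInterArrival P h ε x σ)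
    {r : ℝ≥0∞} (hr : ∀ n, ∫⁻ ω, ENNReal.ofReal (Real.exp (-σ n ω)) ∂P ≤ r) (n : ℕ) :
    ∫⁻ ω, ENNReal.ofReal (Real.exp (-spikeTime (fun k => σ k ω) n)) ∂P ≤ r ^ n := by
  have hexp : Measurable fun y : ℝ => ENNReal.ofReal (Real.exp (-y)) := by fun_prop
  induction n with
  | zero => simp [spikeTime]
  | succ n ih =>
    have h1 : ∀ ω, ENNReal.ofReal (Real.exp (-spikeTime (fun k => σ k ω) (n + 1))) =
        ENNReal.ofReal (Real.exp (-spikeTime (fun k => σ k ω) n)) *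
          ENNReal.ofReal (Real.exp (-σ n ω)) := by
      intro ω
      rw [← ENNReal.ofReal_mul (Real.exp_pos _).le, ← Real.exp_add]
      congr 2
      simp only [spikeTime, Finset.sum_range_succ]
      ring
    simp_rw [h1]
    have h2 := lintegral_mul_eq_lintegral_mul_lintegral_of_indepFun
      (hexp.comp (hσ.measurable_spikeTime n)) (hexp.comp (hσ.measurable n))
      ((hσ.indepFun_spikeTime n).comp hexp hexp)
    refine h2.le.trans ?_
    rw [pow_succ]
    exact mul_le_mul' ih (hr n)

/-- Independence splits the probability; the factor for `τ_n ≤ t` comes from `1_{τ_n ≤ t} ≤ exp(t -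
τ_n)`. -/
theorem IsInterArrival.measure_inter_le [IsProbabilityMeasure P]
    (hσ : IsInterArrival P h ε x σ)
    {r p : ℝ≥0∞} (hr : ∀ n, ∫⁻ ω, ENNReal.ofReal (Real.exp (-σ n ω)) ∂P ≤ r)
    {S : Set ℝ} (hS : MeasurableSet S) (hp : ∀ n, P (σ n ⁻¹' S) ≤ p) (t : ℝ) (n : ℕ) :
    P ((fun ω => spikeTime (fun k => σ k ω) n) ⁻¹' Set.Iic t ∩ σ n ⁻¹' S)
      ≤ ENNReal.ofReal (Real.exp t) * p * r ^ n := by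
  rw [(hσ.indepFun_spikeTime n).measure_inter_preimage_eq_mul _ _ measurableSet_Iic hS]
  have h1 : P ((fun ω => spikeTime (fun k => σ k ω) n) ⁻¹' Set.Iic t)
      ≤ ENNReal.ofReal (Real.exp t) * r ^ n := by
    rw [← lintegral_indicator_one (hσ.measurable_spikeTime n measurableSet_Iic)]
    refine le_trans ?_ (mul_le_mul_right (hσ.lintegral_exp_neg_spikeTime_le hr n) _)
    rw [← lintegral_const_mul' _ _ ENNReal.ofReal_ne_top]
    refine lintegral_mono fun ω => ?_
    by_cases hω : spikeTime (fun k => σ k ω) n ≤ t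
    · refine (Set.indicator_le_self _ _ ω).trans ?_
      rw [← ENNReal.ofReal_mul (Real.exp_pos _).le, ← Real.exp_add, Pi.one_apply,
        ENNReal.one_le_ofReal, Real.one_le_exp_iff]
      linarith
    · rw [Set.indicator_of_notMem (by simpa using hω)]
      exact zero_le
  calc _ ≤ (ENNReal.ofReal (Real.exp t) * r ^ n) * p := mul_le_mul' h1 (hp n)
    _ = _ := by ring

theorem pointProcess_apply {x : ℝ → ℝ} {s : ℕ → ℝ} {A : Set (ℝ × ℝ)} (hA : MeasurableSet A) :
    pointProcess x s A =
      ∑' i, A.indicator 1 (spikeTime s (i + 1), spikeHeight x s (i + 1)) := by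
  rw [pointProcess, Measure.sum_apply _ hA]
  simp_rw [Measure.dirac_apply' _ hA]

/-- The spikes above `δ` are counted even after the first jump time. -/
theorem IsInterArrival.expectedCount_le [IsProbabilityMeasure P]
    (hσ : IsInterArrival P h ε x σ)
    (hx : IsFlow f h ε x) {r p : ℝ≥0∞}
    (hr : ∀ n, ∫⁻ ω, ENNReal.ofReal (Real.exp (-σ n ω)) ∂P ≤ r) {δ : ℝ}
    {S : Set ℝ} (hS : MeasurableSet S) (hxS : ∀ s, 0 ≤ s → δ ≤ x s → s ∈ S)
    (hp : ∀ n, P (σ n ⁻¹' S) ≤ p) (y t : ℝ) :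
    expectedCount P x σ y (Set.Icc 0 t ×ˢ Set.Icc δ 1)
      ≤ ENNReal.ofReal (Real.exp t) * p * (1 - r)⁻¹ := by
  set B : ℕ → Set Ω := fun n =>
    (fun ω => spikeTime (fun k => σ k ω) n) ⁻¹' Set.Iic t ∩ σ n ⁻¹' S with hB
  have hBm : ∀ n, MeasurableSet (B n) := fun n =>
    (hσ.measurable_spikeTime n measurableSet_Iic).inter (hσ.measurable n hS)
  have hA : MeasurableSet (Set.Icc 0 t ×ˢ Set.Icc δ 1 : Set (ℝ × ℝ)) :=
    measurableSet_Icc.prod measurableSet_Icc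
  have hle : ∀ᵐ ω ∂P, pointProcessZero x (fun n => σ n ω) y (Set.Icc 0 t ×ˢ Set.Icc δ 1)
      ≤ ∑' n, (B n).indicator 1 ω := by
    filter_upwards [ae_all_iff.mpr hσ.pos] with ω hω
    refine (Measure.restrict_apply_le _ _).trans ?_
    rw [pointProcess_apply hA]
    refine ENNReal.tsum_le_tsum fun n => ?_
    rw [spikeHeight_succ hx.continuousOn hω]
    by_cases hm : (spikeTime (fun n => σ n ω) (n + 1), x (σ n ω)) ∈
        (Set.Icc 0 t ×ˢ Set.Icc δ 1 : Set (ℝ × ℝ))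
    · have hmB : ω ∈ B n := by
        refine ⟨?_, hxS _ (hω n).le hm.2.1⟩
        -- `τ_{n+1} ≤ t` is weakened to `τ_n ≤ t`, which is independent of `σ n`.
        exact ((spikeTime_strictMono hω).monotone (Nat.le_succ n)).trans hm.1.2
      rw [Set.indicator_of_mem hm, Set.indicator_of_mem hmB, Pi.one_apply, Pi.one_apply]
    · rw [Set.indicator_of_notMem hm]
      exact zero_le
  refine (lintegral_mono_ae hle).trans ?_
  rw [lintegral_tsum fun n => (measurable_one.indicator (hBm n)).aemeasurable]
  simp_rw [lintegral_indicator_one (hBm _)]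
  refine (ENNReal.tsum_le_tsum fun n => hσ.measure_inter_le hr hS hp t n).trans ?_
  rw [ENNReal.tsum_mul_left, ENNReal.tsum_geometric]

end Probability

end Resetting

theorem lemma3p4 {Ω : Type*} [MeasurableSpace Ω] (P : Measure Ω) [IsProbabilityMeasure P]
    (f h : ℝ → ℝ) (hfh : Resetting.Admissible f h)
    (β : ℝ) (hβ : β ∈ Set.Ioo (0 : ℝ) (1 / 2))
    (x : ℝ → ℝ → ℝ) (hx : ∀ ε, 0 < ε → Resetting.IsFlow f h ε (x ε))
    (σ : ℝ → ℕ → Ω → ℝ)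
    (hσ : ∀ ε, 0 < ε → Resetting.IsInterArrival P h ε (x ε) (σ ε))
    (t : ℝ) (ht : 0 < t) :
    ∀ δ : ℝ, 0 < δ → ∃ K : ℝ≥0,
      limsup (fun ε : ℝ => Resetting.expectedCount P (x ε) (σ ε) (Resetting.level β ε)
        (Set.Icc 0 t ×ˢ Set.Icc δ 1)) (𝓝[>] 0) ≤ (K : ℝ≥0∞) := by
  intro δ hδ
  obtain ⟨a, ha0, ha⟩ := hfh.exists_le_mul
  obtain ⟨M, hM⟩ := isCompact_Icc.exists_bound_of_continuousOn hfh.contDiffOn_h.continuousOn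
  have hM' : ∀ y ∈ Set.Icc (0 : ℝ) 1, h y ≤ M := fun y hy => (le_abs_self _).trans (hM y hy)
  -- This is `exp t * (aε/δ) * (exp(-M) ε/2)⁻¹`, where `ε` cancels.
  refine ⟨(Real.exp t * (a / δ) * (2 / Real.exp (-M))).toNNReal, ?_⟩
  refine limsup_le_of_le (by isBoundedDefault) ?_
  filter_upwards [Ioc_mem_nhdsGT (zero_lt_one (α := ℝ))] with ε hε
  have hε0 : 0 < ε := hε.1
  obtain ⟨S, hS, hxS, hp⟩ := (hσ ε hε0).exists_time hfh (hx ε hε0) hε0 ha0 ha hδ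
  refine ((hσ ε hε0).expectedCount_le (hx ε hε0)
    ((hσ ε hε0).lintegral_exp_neg_le hfh (hx ε hε0) hε0 hε.2 hM') hS hxS hp _ t).trans ?_
  have hq : 0 < Real.exp (-M) := Real.exp_pos _
  have hr : ENNReal.ofReal (Real.exp (-M) * (ε / 2)) ≤
      1 - ENNReal.ofReal (1 - Real.exp (-M) * (ε / 2)) := by
    have hM0 : 0 ≤ M := (norm_nonneg _).trans (hM 0 (by simp))
    have hq1 : Real.exp (-M) ≤ 1 := Real.exp_le_one_iff.mpr (by linarith)
    have : Real.exp (-M) * (ε / 2) ≤ 1 := by nlinarith [hε.2]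
    rw [← ENNReal.ofReal_one, ← ENNReal.ofReal_sub _ (by linarith)]
    exact ENNReal.ofReal_le_ofReal (by linarith)
  refine (mul_le_mul_right (ENNReal.inv_le_inv.mpr hr) _).trans ?_
  have hc : 0 < Real.exp (-M) * (ε / 2) := by positivity
  rw [← ENNReal.ofReal_inv_of_pos hc, ← ENNReal.ofReal_mul (Real.exp_pos _).le,
    ← ENNReal.ofReal_mul (by positivity)]
  refine ENNReal.ofReal_le_ofReal (le_of_eq ?_)
  field_simp
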